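/- Let $n\ge 1$ be an integer and let $\mathcal H^{s}$ denote the $s$-dimensional Hausdorff measure on $\mathbb R^n$ with the Euclidean metric, normalized by $\mathcal H^{s}(A)=\lim_{\delta\to0}\inf\{\sum_i \operatorname{diam}(U_i)^s : A\subseteq\bigcup_i U_i,\ \operatorname{diam}(U_i)\le\delta\}$ over countable covers (for $s=0$, counting measure). An $n$-cube antichain is a set $S\subseteq[0,1]^n$ that contains no two distinct points $x,y$ with $x_i\le y_i$ for all $i$. Call $S$ smooth if it is $\mathcal H^{n-1}$-measurable and each $x\in S$ has an open neighbourhood $U$ and a $C^1$ function $g:U\to\mathbb R$ with $\nabla g(x)\ne0$ and $g=0$ on $S\cap U$. (This includes all embedded $C^1$, in particular $C^\infty$, hypersurfaces with or without boundary and corners, and the graph $x_n=f(x_1,\dots,x_{n-1})$ of any function $f$ on a measurable set that extends locally to a $C^1$ function.) For $1\le j\le n$ let $\pi_j(x_1,\dots,x_n)=(x_1,\dots,x_{j-1},0,x_{j+1},\dots,x_n)$, and let $\sigma_m=\dfrac{2^m\,\Gamma(m/2+1)}{\pi^{m/2}}$. If $S$ is a smooth $n$-cube antichain, then \[\mathcal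 H^{n-1}(S)\le\sum_{j=1}^n\mathcal H^{n-1}(\pi_j(S)),\] and moreover $\mathcal H^{n-1}(S)\le n\,\sigma_{n-1}$. -/

import Mathlib

open MeasureTheory Topology

/-- An `n`-cube antichain: a subset of `[0,1]^n` that does not contain two (distinct) points
`x`, `y` with `x i ≤ y i` for all `i`. -/
def IsCubeAntichain {n : ℕ} (S : Set (EuclideanSpace ℝ (Fin n))) : Prop :=
  (∀ x ∈ S, ∀ i, x i ∈ Set.Icc (0 : ℝ) 1) ∧
    IsAntichain (fun x y : EuclideanSpace ℝ (Fin n) => ∀ i, x i ≤ y i) S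

/-- `S` is a smooth hypersurface piece in `ℝ^n`: it is `H^{n-1}`-measurable, and near each of its
points it lies in a regular level set `{g = 0}` of a `C¹` function `g`.

This covers embedded hypersurfaces of class `C¹` (in particular `C^∞`), without boundary or with
boundary and corners, as well as graphs `x_n = f (x_1, …, x_{n-1})` of `C¹` functions over an
arbitrary measurable domain (take `g = x_n - f`). Measurability is automatic for an embedded
hypersurface; it has to be mentioned only because no shape of the domain is prescribed. -/
structure IsSmoothHypersurface {n : ℕ} (S : Set (EuclideanSpace ℝ (Fin n))) : Prop where
  measurable : NullMeasurableSet S (μH[((n - 1 : ℕ) : ℝ)])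
  exists_defining : ∀ x ∈ S, ∃ g : EuclideanSpace ℝ (Fin n) → ℝ,
    ContDiffAt ℝ 1 g x ∧ fderiv ℝ g x ≠ 0 ∧ ∀ᶠ y in 𝓝[S] x, g y = 0

/-- The projection `π_j`, which sets the `j`-th coordinate to zero. -/
def coordProj {n : ℕ} (j : Fin n) (x : EuclideanSpace ℝ (Fin n)) : EuclideanSpace ℝ (Fin n) :=
  WithLp.toLp 2 (Function.update x.ofLp j 0)

/-- `σ_m = 2^m Γ(m/2 + 1) / π^{m/2}`. -/
noncomputable def sigmaConst (m : ℕ) : ℝ :=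
  2 ^ m * Real.Gamma ((m : ℝ) / 2 + 1) / Real.pi ^ ((m : ℝ) / 2)

/-!
Near each of its points `S` lies in a level set, which the implicit function theorem parametrizes
by a map `φ : ℝ^m → ℝ^(m+1)` whose derivative at the base point is a linear isometry `L`. Close to
that point `φ` increases `H^m` by a factor at most `1 + ε`, while `π_j ∘ φ` scales it by a factor
at least `(1 - ε) |det (π_j ∘ L)|`, and these minors of `L` satisfy `∑_j |det (π_j ∘ L)| ≥ 1`. So
the inequality holds locally up to a factor tending to `1`. In an antichain no two points differ
in one coordinate only, hence each `π_j` is injective on `S`; so `A ↦ H^m (π_j A)` is a measure on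
`S`, and the local inequality of measures is a global one.

The constant `σ_m` is the factor with `σ_m vol (B (x, r)) = (2 r)^m`, so covering by small balls
with almost no overlap bounds `H^m` by `σ_m vol`; the projections lie in unit cubes.
-/

open Filter Metric Set
open scoped NNReal ENNReal

section CoordinateProjections

variable {m n : ℕ}

/-- The linear map `ℝ^(m+1) → ℝ^m` that forgets the `j`-th coordinate: the projection `π_j`, with
values in a space whose dimension is that of the Hausdorff measure. -/
noncomputable def dropCoord (j : Fin (m + 1)) :
    EuclideanSpace ℝ (Fin (m + 1)) →L[ℝ] EuclideanSpace ℝ (Fin m) where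
  toFun x := WithLp.toLp 2 fun i => x (j.succAbove i)
  map_add' _ _ := rfl
  map_smul' _ _ := rfl
  cont := by fun_prop

@[simp]
theorem dropCoord_apply (j : Fin (m + 1)) (x : EuclideanSpace ℝ (Fin (m + 1))) (i : Fin m) :
    dropCoord j x i = x (j.succAbove i) := rfl

theorem isometry_toLp_insertNth_zero (j : Fin (m + 1)) :
    Isometry fun u : EuclideanSpace ℝ (Fin m) =>
      (WithLp.toLp 2 (j.insertNth (α := fun _ => ℝ) 0 u.ofLp) :
        EuclideanSpace ℝ (Fin (m + 1))) := by
  refine Isometry.of_dist_eq fun u v => ?_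
  simp [EuclideanSpace.dist_eq, Fin.sum_univ_succAbove _ j]

theorem coordProj_eq_toLp_insertNth_zero (j : Fin (m + 1)) (x : EuclideanSpace ℝ (Fin (m + 1))) :
    coordProj j x = WithLp.toLp 2 (j.insertNth (α := fun _ => ℝ) 0 (dropCoord j x).ofLp) := by
  ext i
  rcases Fin.eq_self_or_eq_succAbove j i with rfl | ⟨i, rfl⟩ <;> simp [coordProj]

theorem hausdorffMeasure_coordProj_image (j : Fin (m + 1))
    (A : Set (EuclideanSpace ℝ (Fin (m + 1)))) {d : ℝ} (hd : 0 ≤ d) :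
    μH[d] (coordProj j '' A) = μH[d] (dropCoord j '' A) := by
  rw [← (isometry_toLp_insertNth_zero j).hausdorffMeasure_image (Or.inl hd), image_image]
  simp only [coordProj_eq_toLp_insertNth_zero]

theorem continuous_coordProj (j : Fin n) : Continuous (coordProj j) := by
  unfold coordProj
  fun_prop

theorem injOn_coordProj_of_isAntichain {S : Set (EuclideanSpace ℝ (Fin n))}
    (hS : IsAntichain (fun x y : EuclideanSpace ℝ (Fin n) => ∀ i, x i ≤ y i) S) (j : Fin n) :
    InjOn (coordProj j) S := by
  intro x hx y hy hxy
  have heq : ∀ i ≠ j, x i = y i := fun i hi => by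
    simpa [coordProj, hi] using congrArg (fun z : EuclideanSpace ℝ (Fin n) => z i) hxy
  have hle : ∀ {u v : EuclideanSpace ℝ (Fin n)}, (∀ i ≠ j, u i = v i) → u j ≤ v j →
      ∀ i, u i ≤ v i := fun huv hj i => by
    by_cases hi : i = j
    · exact hi ▸ hj
    · exact (huv i hi).le
  rcases le_total (x j) (y j) with h | h
  · exact hS.eq hx hy (hle heq h)
  · exact hS.eq' hx hy (hle (fun i hi => (heq i hi).symm) h)

end CoordinateProjections

section HausdorffMeasureUpperBound

theorem hausdorffMeasure_le_of_ediam_closedBall_rpow_le {X : Type*} [MetricSpace X]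
    [SecondCountableTopology X] [HasBesicovitchCovering X] [MeasurableSpace X] [BorelSpace X]
    {μ : Measure X} [SFinite μ] [μ.OuterRegular] {d : ℝ} {C : ℝ≥0∞} (hC : C ≠ ∞)
    (hball : ∀ x : X, ∀ r > 0, ediam (closedBall x r) ^ d ≤ C * μ (closedBall x r)) (s : Set X) :
    μH[d] s ≤ C * μ s := by
  have hcover : ∀ k : ℕ, ∃ (t : Set X) (r : X → ℝ), t.Countable ∧ t ⊆ s ∧
      (∀ x ∈ t, r x ∈ Ioo 0 (1 / ((k : ℝ) + 1))) ∧ (s ⊆ ⋃ x ∈ t, closedBall x (r x)) ∧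
      (∑' x : t, μ (closedBall (x : X) (r x))) ≤ μ s + (k : ℝ≥0∞)⁻¹ := fun k =>
    Besicovitch.exists_closedBall_covering_tsum_measure_le μ (by simp)
      (fun _ => Ioo 0 (1 / ((k : ℝ) + 1))) s fun x _ δ hδ => by
        rw [Ioo_inter_Ioo, nonempty_Ioo, max_self]
        exact lt_min Nat.one_div_pos_of_nat hδ
  choose t r ht _ hr hst hvol using hcover
  have (k : ℕ) : Countable (t k) := (ht k).to_subtype
  have hdiam : ∀ k, ∀ x : t k,
      ediam (closedBall (x : X) (r k x)) ≤ 2 * ENNReal.ofReal (1 / ((k : ℝ) + 1)) := fun k x => by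
    rw [← Metric.closedEBall_ofReal (hr k x x.2).1.le]
    refine Metric.ediam_closedEBall_le.trans ?_
    gcongr
    exact (hr k x x.2).2.le
  have hdiam_lim : Tendsto (fun k : ℕ => 2 * ENNReal.ofReal (1 / ((k : ℝ) + 1))) atTop (𝓝 0) := by
    simpa using ENNReal.Tendsto.const_mul
      (ENNReal.tendsto_ofReal (tendsto_one_div_add_atTop_nhds_zero_nat (𝕜 := ℝ)))
      (Or.inr ENNReal.ofNat_ne_top)
  have hsum : ∀ k, ∑' x : t k, ediam (closedBall (x : X) (r k x)) ^ d ≤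
      C * (μ s + (k : ℝ≥0∞)⁻¹) := fun k => calc
    _ ≤ ∑' x : t k, C * μ (closedBall (x : X) (r k x)) :=
      ENNReal.tsum_le_tsum fun x => hball x _ (hr k x x.2).1
    _ ≤ C * (μ s + (k : ℝ≥0∞)⁻¹) := by
      rw [ENNReal.tsum_mul_left]
      gcongr
      exact hvol k
  have hsum_lim : Tendsto (fun k : ℕ => C * (μ s + (k : ℝ≥0∞)⁻¹)) atTop (𝓝 (C * μ s)) := by
    simpa using ENNReal.Tendsto.const_mul
      (ENNReal.tendsto_inv_nat_nhds_zero.const_add (μ s)) (Or.inr hC)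
  calc μH[d] s ≤ liminf (fun k => ∑' x : t k, ediam (closedBall (x : X) (r k x)) ^ d) atTop :=
        Measure.hausdorffMeasure_le_liminf_tsum d s _ hdiam_lim _ (.of_forall hdiam)
          (.of_forall fun k => by simpa only [iUnion_subtype] using hst k)
    _ ≤ liminf (fun k : ℕ => C * (μ s + (k : ℝ≥0∞)⁻¹)) atTop :=
      liminf_le_liminf (.of_forall hsum)
    _ = C * μ s := hsum_lim.liminf_eq

theorem sigmaConst_nonneg (m : ℕ) : 0 ≤ sigmaConst m :=
  div_nonneg (mul_nonneg (by positivity) (Real.Gamma_nonneg_of_nonneg (by positivity)))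
    (by positivity)

theorem volume_unitCube (m : ℕ) :
    volume {x : EuclideanSpace ℝ (Fin m) | ∀ i, x i ∈ Icc (0 : ℝ) 1} = 1 := by
  have h := (EuclideanSpace.volume_preserving_symm_measurableEquiv_toLp (Fin m)).measure_preimage
    (s := Icc 0 1) measurableSet_Icc.nullMeasurableSet
  rw [Real.volume_Icc_pi] at h
  convert! h using 2
  · ext x
    simp [Pi.le_def, forall_and]
  · simp

theorem sigmaConst_mul_volume_closedBall {m : ℕ} (x : EuclideanSpace ℝ (Fin m)) {r : ℝ}
    (hr : 0 ≤ r) :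
    ENNReal.ofReal (sigmaConst m) * volume (closedBall x r) = ENNReal.ofReal (2 * r) ^ m := by
  rcases Nat.eq_zero_or_pos m with rfl | hm
  · have hball : closedBall x r = {y | ∀ i, y i ∈ Icc (0 : ℝ) 1} := by
      ext y
      simpa [Subsingleton.elim y x] using hr
    rw [hball, volume_unitCube]
    simp [sigmaConst]
  · have : Nonempty (Fin m) := ⟨⟨0, hm⟩⟩
    have hΓ : 0 < Real.Gamma ((m : ℝ) / 2 + 1) := Real.Gamma_pos_of_pos (by positivity)
    have hπ : √Real.pi ^ m = Real.pi ^ ((m : ℝ) / 2) := by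
      rw [Real.sqrt_eq_rpow, ← Real.rpow_mul_natCast Real.pi_pos.le]
      ring_nf
    rw [EuclideanSpace.volume_closedBall, Fintype.card_fin, hπ, ← ENNReal.ofReal_pow hr,
      ← ENNReal.ofReal_pow (by positivity), ← ENNReal.ofReal_mul (by positivity),
      ← ENNReal.ofReal_mul (sigmaConst_nonneg m), sigmaConst, mul_pow]
    field_simp [hΓ.ne']

theorem hausdorffMeasure_le_sigmaConst_mul_volume {m : ℕ} (s : Set (EuclideanSpace ℝ (Fin m))) :
    μH[(m : ℝ)] s ≤ ENNReal.ofReal (sigmaConst m) * volume s := by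
  refine hausdorffMeasure_le_of_ediam_closedBall_rpow_le ENNReal.ofReal_ne_top (fun x r hr => ?_) s
  rw [sigmaConst_mul_volume_closedBall x hr.le, ENNReal.rpow_natCast,
    ENNReal.ofReal_mul zero_le_two, ENNReal.ofReal_ofNat, ← Metric.closedEBall_ofReal hr.le]
  gcongr
  exact Metric.ediam_closedEBall_le

theorem hausdorffMeasure_coordProj_image_le_sigmaConst {m : ℕ}
    {S : Set (EuclideanSpace ℝ (Fin (m + 1)))} (hS : ∀ x ∈ S, ∀ i, x i ∈ Icc (0 : ℝ) 1)
    (j : Fin (m + 1)) : μH[(m : ℝ)] (coordProj j '' S) ≤ ENNReal.ofReal (sigmaConst m) := by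
  have hsub : dropCoord j '' S ⊆ {u | ∀ i, u i ∈ Icc (0 : ℝ) 1} :=
    image_subset_iff.2 fun x hx i => hS x hx (j.succAbove i)
  calc μH[(m : ℝ)] (coordProj j '' S) = μH[(m : ℝ)] (dropCoord j '' S) :=
        hausdorffMeasure_coordProj_image j S m.cast_nonneg
    _ ≤ μH[(m : ℝ)] {u : EuclideanSpace ℝ (Fin m) | ∀ i, u i ∈ Icc (0 : ℝ) 1} := measure_mono hsub
    _ ≤ ENNReal.ofReal (sigmaConst m) :=
      (hausdorffMeasure_le_sigmaConst_mul_volume _).trans_eq (by rw [volume_unitCube, mul_one])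

end HausdorffMeasureUpperBound

section Minors

variable {m : ℕ}

theorem exists_orthonormalBasis_succ_eq
    (L : EuclideanSpace ℝ (Fin m) →ₗᵢ[ℝ] EuclideanSpace ℝ (Fin (m + 1))) :
    ∃ b : OrthonormalBasis (Fin (m + 1)) ℝ (EuclideanSpace ℝ (Fin (m + 1))),
      ∀ k : Fin m, b k.succ = L (EuclideanSpace.basisFun (Fin m) ℝ k) := by
  have hL : Orthonormal ℝ (L ∘ EuclideanSpace.basisFun (Fin m) ℝ) :=
    (EuclideanSpace.basisFun (Fin m) ℝ).orthonormal.comp_linearIsometry L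
  have hcons : Orthonormal ℝ (({0}ᶜ : Set (Fin (m + 1))).domRestrict
      (Fin.cons 0 (L ∘ EuclideanSpace.basisFun (Fin m) ℝ) :
        Fin (m + 1) → EuclideanSpace ℝ (Fin (m + 1)))) := by
    convert! hL.comp (fun i : ({0}ᶜ : Set (Fin (m + 1))) => Fin.pred i i.2)
      fun i k h => Subtype.ext (Fin.pred_inj.1 h) using 1
    ext1 ⟨i, hi⟩
    obtain ⟨k, rfl⟩ := Fin.exists_succ_eq.2 hi
    exact congrArg (L ∘ EuclideanSpace.basisFun (Fin m) ℝ) (Fin.pred_succ k).symm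
  obtain ⟨b, hb⟩ := hcons.exists_orthonormalBasis_extension_of_card_eq (by simp)
  exact ⟨b, fun k => by simpa using hb k.succ (Fin.succ_ne_zero k)⟩

theorem abs_det_of_orthonormalBasis {ι : Type*} [Fintype ι] [DecidableEq ι]
    (b : OrthonormalBasis ι ℝ (EuclideanSpace ℝ ι)) :
    |(Matrix.of fun i k => b k i).det| = 1 := by
  have hM : (EuclideanSpace.basisFun ι ℝ).toBasis.toMatrix b = Matrix.of fun i k => b k i := by
    ext i k
    simp [Module.Basis.toMatrix_apply]
  have h := (EuclideanSpace.basisFun ι ℝ).det_to_matrix_orthonormalBasis_real b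
  rw [Module.Basis.det_apply, hM] at h
  rcases h with h | h <;> simp [h]

/-- Expand an orthogonal determinant, with the image of `L` as its last columns, along its first
column: the cofactors are the minors of `L` and the entries have absolute value at most `1`. -/
theorem one_le_sum_abs_det_dropCoord_comp
    (L : EuclideanSpace ℝ (Fin m) →ₗᵢ[ℝ] EuclideanSpace ℝ (Fin (m + 1))) :
    1 ≤ ∑ j, |((dropCoord j).comp L.toContinuousLinearMap).det| := by
  obtain ⟨b, hb⟩ := exists_orthonormalBasis_succ_eq L
  have hminor : ∀ j : Fin (m + 1), ((dropCoord j).comp L.toContinuousLinearMap).det =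
      ((Matrix.of fun i k => b k i).submatrix j.succAbove Fin.succ).det := fun j => by
    rw [ContinuousLinearMap.det, ← LinearMap.det_toMatrix (EuclideanSpace.basisFun _ ℝ).toBasis]
    congr 1
    ext i k
    simp [LinearMap.toMatrix_apply, hb]
  calc 1 = |(Matrix.of fun i k => b k i).det| := (abs_det_of_orthonormalBasis b).symm
    _ ≤ ∑ j : Fin (m + 1), |(-1) ^ (j : ℕ) * b 0 j *
          ((Matrix.of fun i k => b k i).submatrix j.succAbove Fin.succ).det| := by
      rw [Matrix.det_succ_column_zero]
      exact Finset.abs_sum_le_sum_abs _ _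
    _ ≤ ∑ j, |((dropCoord j).comp L.toContinuousLinearMap).det| := by
      refine Finset.sum_le_sum fun j _ => ?_
      have hb0 : |b 0 j| ≤ 1 := by simpa using PiLp.norm_apply_le (b 0) j
      rw [hminor, abs_mul, abs_mul, abs_pow, abs_neg, abs_one, one_pow, one_mul]
      exact mul_le_of_le_one_left (abs_nonneg _) hb0

end Minors

section StrictlyDifferentiableImages

theorem eventually_smallSets_mul_abs_det_mul_le_addHaar_image {E : Type*} [NormedAddCommGroup E]
    [NormedSpace ℝ E] [FiniteDimensional ℝ E] [MeasurableSpace E] [BorelSpace E] (μ : Measure E)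
    [μ.IsAddHaarMeasure] {f : E → E} {f' : E →L[ℝ] E} {a : E} (hf : HasStrictFDerivAt f f' a)
    {c : ℝ≥0∞} (hc : c < 1) :
    ∀ᶠ s in (𝓝 a).smallSets, c * ENNReal.ofReal |f'.det| * μ s ≤ μ (f '' s) := by
  rcases eq_or_ne f'.det 0 with hdet | hdet
  · simp [hdet]
  have hlt : c * ENNReal.ofReal |f'.det| < ENNReal.ofReal |f'.det| := by
    simpa using ENNReal.mul_lt_mul_left (by simpa using hdet) ENNReal.ofReal_ne_top hc
  lift c * ENNReal.ofReal |f'.det| to ℝ≥0 using hlt.ne_top with q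
  obtain ⟨δ, hδ, hδ_pos⟩ :=
    ((mul_le_addHaar_image_of_lt_det μ f' hlt).and self_mem_nhdsWithin).exists
  obtain ⟨U, hU, hfU⟩ := hf.approximates_deriv_on_nhds (Or.inr hδ_pos)
  exact eventually_smallSets.2 ⟨U, hU, fun s hs => hδ s f (hfU.mono_set hs)⟩

theorem eventually_smallSets_mul_hausdorffMeasure_image_le {E F : Type*} [NormedAddCommGroup E]
    [NormedSpace ℝ E] [MeasurableSpace E] [BorelSpace E] [NormedAddCommGroup F] [NormedSpace ℝ F]
    [MeasurableSpace F] [BorelSpace F] {f : E → F} {f' : E →L[ℝ] F} {a : E}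
    (hf : HasStrictFDerivAt f f' a) (hf' : ‖f'‖ ≤ 1) {d : ℝ} (hd : 0 ≤ d) {c : ℝ≥0∞} (hc : c < 1) :
    ∀ᶠ s in (𝓝 a).smallSets, c * μH[d] (f '' s) ≤ μH[d] s := by
  have hlim : Tendsto (fun K : ℝ≥0 => c * (K : ℝ≥0∞) ^ d) (𝓝[>] 1) (𝓝 c) := by
    have hcont : Continuous fun K : ℝ≥0 => (K : ℝ≥0∞) ^ d := by fun_prop
    simpa using ENNReal.Tendsto.const_mul (hcont.continuousWithinAt (s := Ioi 1) (x := 1))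
      (Or.inr hc.ne_top)
  obtain ⟨K, hcK, hK⟩ := ((hlim.eventually_le_const hc).and self_mem_nhdsWithin).exists
  obtain ⟨U, hU, hfU⟩ := hf.exists_lipschitzOnWith_of_nnnorm_lt K (lt_of_le_of_lt hf' hK)
  refine eventually_smallSets.2 ⟨U, hU, fun s hs => ?_⟩
  calc c * μH[d] (f '' s) ≤ c * ((K : ℝ≥0∞) ^ d * μH[d] s) := by
        gcongr
        exact (hfU.mono hs).hausdorffMeasure_image_le hd
    _ ≤ μH[d] s := by
      rw [← mul_assoc]
      exact mul_le_of_le_one_left' hcK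

theorem eventually_smallSets_mul_hausdorffMeasure_image_le_sum {m : ℕ}
    {φ : EuclideanSpace ℝ (Fin m) → EuclideanSpace ℝ (Fin (m + 1))}
    {L : EuclideanSpace ℝ (Fin m) →ₗᵢ[ℝ] EuclideanSpace ℝ (Fin (m + 1))}
    {a : EuclideanSpace ℝ (Fin m)} (hφ : HasStrictFDerivAt φ L.toContinuousLinearMap a)
    {c c' : ℝ≥0∞} (hc : c < 1) (hc' : c' < 1) :
    ∀ᶠ s in (𝓝 a).smallSets,
      c * (c' * μH[(m : ℝ)] (φ '' s)) ≤ ∑ j, μH[(m : ℝ)] (coordProj j '' (φ '' s)) := by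
  have hdet : (1 : ℝ≥0∞) ≤
      ∑ j, ENNReal.ofReal |((dropCoord j).comp L.toContinuousLinearMap).det| := by
    rw [← ENNReal.ofReal_sum_of_nonneg fun _ _ => abs_nonneg _, ENNReal.one_le_ofReal]
    exact one_le_sum_abs_det_dropCoord_comp L
  have hproj : ∀ᶠ s in (𝓝 a).smallSets, ∀ j,
      c * ENNReal.ofReal |((dropCoord j).comp L.toContinuousLinearMap).det| * μH[(m : ℝ)] s ≤
        μH[(m : ℝ)] ((dropCoord j ∘ φ) '' s) :=
    eventually_all.2 fun j => eventually_smallSets_mul_abs_det_mul_le_addHaar_image _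
      ((dropCoord j).hasStrictFDerivAt.comp a hφ) hc
  filter_upwards [hproj, eventually_smallSets_mul_hausdorffMeasure_image_le hφ
    L.norm_toContinuousLinearMap_le m.cast_nonneg hc'] with s hs hs'
  calc c * (c' * μH[(m : ℝ)] (φ '' s)) ≤ c * (1 * μH[(m : ℝ)] s) := by
        rw [one_mul]
        gcongr
    _ ≤ c * ((∑ j, ENNReal.ofReal |((dropCoord j).comp L.toContinuousLinearMap).det|) *
          μH[(m : ℝ)] s) := by gcongr
    _ = ∑ j, c * ENNReal.ofReal |((dropCoord j).comp L.toContinuousLinearMap).det| *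
          μH[(m : ℝ)] s := by
      simp_rw [Finset.sum_mul, Finset.mul_sum, mul_assoc]
    _ ≤ ∑ j, μH[(m : ℝ)] (coordProj j '' (φ '' s)) :=
      Finset.sum_le_sum fun j _ => by
        rw [hausdorffMeasure_coordProj_image j _ m.cast_nonneg, ← image_comp]
        exact hs j

end StrictlyDifferentiableImages

section LevelSets

theorem exists_isometric_parametrization_levelSet {E : Type*} [NormedAddCommGroup E]
    [InnerProductSpace ℝ E] [FiniteDimensional ℝ E] {m : ℕ} (hE : Module.finrank ℝ E = m + 1)
    {g : E → ℝ} {g' : E →L[ℝ] ℝ} {x : E} (hg : HasStrictFDerivAt g g' x) (hg' : g' ≠ 0) :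
    ∃ (φ : EuclideanSpace ℝ (Fin m) → E) (L : EuclideanSpace ℝ (Fin m) →ₗᵢ[ℝ] E),
      HasStrictFDerivAt φ L.toContinuousLinearMap 0 ∧
        ∀ U ∈ 𝓝 (0 : EuclideanSpace ℝ (Fin m)), ∀ᶠ y in 𝓝 x, g y = g x → y ∈ φ '' U := by
  have hrange : g'.range = ⊤ := LinearMap.range_eq_top.2 <|
    LinearMap.surjective fun h => hg' (ContinuousLinearMap.coe_injective h)
  have hker : Module.finrank ℝ g'.ker = m := by
    have h := Module.Dual.finrank_ker_add_one_of_ne_zero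
      (f := (g' : E →ₗ[ℝ] ℝ)) fun h => hg' (ContinuousLinearMap.coe_injective h)
    rw [hE] at h
    exact Nat.succ_injective h
  let e : EuclideanSpace ℝ (Fin m) ≃ₗᵢ[ℝ] g'.ker :=
    ((stdOrthonormalBasis ℝ g'.ker).reindex (finCongr hker)).repr.symm
  let ψ : E → g'.ker := fun y => (hg.implicitToOpenPartialHomeomorph g g' hrange y).2
  have hψ : Tendsto (e.symm ∘ ψ) (𝓝 x) (𝓝 0) := by
    have hcont : ContinuousAt (e.symm ∘ ψ) x :=
      e.symm.continuous.continuousAt.comp <| continuousAt_snd.comp <|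
        (hg.implicitToOpenPartialHomeomorph g g' hrange).continuousAt
          (hg.mem_implicitToOpenPartialHomeomorph_source hrange)
    simpa [ContinuousAt, ψ] using hcont
  refine ⟨hg.implicitFunction g g' hrange (g x) ∘ e,
    g'.ker.subtypeₗᵢ.comp e.toLinearIsometry, ?_, fun U hU => ?_⟩
  · have h0 : HasStrictFDerivAt (hg.implicitFunction g g' hrange (g x)) g'.ker.subtypeL (e 0) := by
      simpa using hg.to_implicitFunction hrange
    exact h0.comp 0 e.toContinuousLinearEquiv.hasStrictFDerivAt
  · filter_upwards [hg.eq_implicitFunction hrange, hψ hU] with y hy hyU hgy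
    exact ⟨e.symm (ψ y), hyU, by simpa [hgy] using hy⟩

end LevelSets

section Localization

theorem measure_le_of_locally_le {X : Type*} [TopologicalSpace X] [SecondCountableTopology X]
    [MeasurableSpace X] [OpensMeasurableSpace X] {μ ν : Measure X}
    (h : ∀ x, ∀ᶠ A in (𝓝 x).smallSets, μ A ≤ ν A) : μ ≤ ν := by
  simp only [eventually_smallSets] at h
  choose U hU hμν using h
  obtain ⟨t, ht, htU⟩ :=
    TopologicalSpace.countable_cover_nhds fun x => interior_mem_nhds.2 (hU x)
  rcases isEmpty_or_nonempty X with hX | hX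
  · simp [Measure.eq_zero_of_isEmpty]
  obtain ⟨u, hu⟩ := countable_iff_exists_subset_range.1 ht
  set D : ℕ → Set X := disjointed fun k => interior (U (u k)) with hD
  have hDU (k : ℕ) : D k ⊆ U (u k) := (disjointed_subset _ k).trans interior_subset
  have hD_meas (k : ℕ) : MeasurableSet (D k) :=
    MeasurableSet.disjointed (fun _ => isOpen_interior.measurableSet) k
  have hD_univ : ⋃ k, D k = univ := by
    rw [hD, iUnion_disjointed, eq_univ_iff_forall]
    intro x
    obtain ⟨y, hy, hxy⟩ := mem_iUnion₂.1 (htU ▸ mem_univ x)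
    obtain ⟨k, rfl⟩ := hu hy
    exact mem_iUnion.2 ⟨k, hxy⟩
  refine Measure.le_iff.2 fun s hs => ?_
  have hs_union : ⋃ k, s ∩ D k = s := by rw [← inter_iUnion, hD_univ, inter_univ]
  calc μ s = μ (⋃ k, s ∩ D k) := by rw [hs_union]
    _ ≤ ∑' k, μ (s ∩ D k) := measure_iUnion_le _
    _ ≤ ∑' k, ν (s ∩ D k) :=
      ENNReal.tsum_le_tsum fun k => hμν _ _ (inter_subset_right.trans (hDU k))
    _ = ν (⋃ k, s ∩ D k) :=
      (measure_iUnion ((disjoint_disjointed _).mono fun _ _ hkl =>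
        hkl.mono inter_subset_right inter_subset_right) fun k => hs.inter (hD_meas k)).symm
    _ = ν s := by rw [hs_union]

/-- Injectivity makes `A ↦ ν (f j '' A)` a measure on the subsets of `T` (Lusin–Souslin), so that a
local comparison of measures applies. -/
theorem mul_measure_le_sum_measure_image_of_locally {X Y ι : Type*} [Fintype ι]
    [TopologicalSpace X] [PolishSpace X] [MeasurableSpace X] [BorelSpace X]
    [TopologicalSpace Y] [T2Space Y] [MeasurableSpace Y] [BorelSpace Y]
    {μ : Measure X} {ν : Measure Y} {f : ι → X → Y} {T : Set X} (hT : MeasurableSet T)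
    (hf : ∀ j, ContinuousOn (f j) T) (hinj : ∀ j, InjOn (f j) T) {c : ℝ≥0∞}
    (hloc : ∀ x ∈ T, ∀ᶠ A in (𝓝[T] x).smallSets, c * μ A ≤ ∑ j, ν (f j '' A)) :
    c * μ T ≤ ∑ j, ν (f j '' T) := by
  have hval : MeasurableEmbedding (Subtype.val : T → X) := .subtype_coe hT
  have hemb (j : ι) : MeasurableEmbedding (T.domRestrict (f j)) :=
    (hf j).measurableEmbedding hT (hinj j)
  have himage (j : ι) (A : Set T) :
      (T.domRestrict (f j)) '' A = f j '' (Subtype.val '' A) := by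
    rw [domRestrict_eq, image_comp]
  have hle : c • μ.comap (Subtype.val : T → X) ≤
      ∑ j, ν.comap (T.domRestrict (f j)) := by
    refine measure_le_of_locally_le fun x => ?_
    have hx : Tendsto (Subtype.val : T → X) (𝓝 x) (𝓝[T] x) :=
      (map_nhds_subtype_val x).le
    filter_upwards [hx.image_smallSets.eventually (hloc x x.2)] with A hA
    simpa [Measure.finsetSum_apply, hval.comap_apply, (hemb _).comap_apply, himage] using hA
  simpa [Measure.finsetSum_apply, hval.comap_apply, (hemb _).comap_apply, himage] using hle univ

end Localization

section SmoothHypersurfaces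

variable {m : ℕ} {S : Set (EuclideanSpace ℝ (Fin (m + 1)))}

theorem IsSmoothHypersurface.eventually_smallSets_mul_hausdorffMeasure_le_sum
    (hS : IsSmoothHypersurface S) {x : EuclideanSpace ℝ (Fin (m + 1))} (hx : x ∈ S)
    {c c' : ℝ≥0∞} (hc : c < 1) (hc' : c' < 1) :
    ∀ᶠ A in (𝓝[S] x).smallSets,
      c * (c' * μH[(m : ℝ)] A) ≤ ∑ j, μH[(m : ℝ)] (coordProj j '' A) := by
  obtain ⟨g, hg, hg', hgS⟩ := hS.exists_defining x hx
  obtain ⟨φ, L, hφ, hcover⟩ :=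
    exists_isometric_parametrization_levelSet (m := m) (by simp)
      (hg.hasStrictFDerivAt one_ne_zero) hg'
  obtain ⟨U, hU, hφU⟩ := eventually_smallSets.1
    (eventually_smallSets_mul_hausdorffMeasure_image_le_sum hφ hc hc')
  have hmem : φ '' U ∈ 𝓝[S] x := by
    filter_upwards [hgS, nhdsWithin_le_nhds (hcover U hU)] with y hy hyU
    exact hyU (hy.trans (hgS.self_of_nhdsWithin hx).symm)
  filter_upwards [eventually_smallSets_subset.2 hmem] with A hA
  obtain ⟨s, hs, rfl⟩ := subset_image_iff.1 hA
  exact hφU s hs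

theorem IsSmoothHypersurface.hausdorffMeasure_le_sum_coordProj (hS : IsSmoothHypersurface S)
    (hinj : ∀ j, InjOn (coordProj j) S) :
    μH[(m : ℝ)] S ≤ ∑ j, μH[(m : ℝ)] (coordProj j '' S) := by
  obtain ⟨T, hTS, hT, hTae⟩ := hS.measurable.exists_measurable_subset_ae_eq
  have hmul : ∀ c < 1, ∀ c' < 1,
      c * (c' * μH[(m : ℝ)] T) ≤ ∑ j, μH[(m : ℝ)] (coordProj j '' T) := by
    intro c hc c' hc'
    rw [← mul_assoc]
    refine mul_measure_le_sum_measure_image_of_locally hT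
      (fun j => (continuous_coordProj j).continuousOn) (fun j => (hinj j).mono hTS) fun x hx => ?_
    simp_rw [mul_assoc]
    exact (hS.eventually_smallSets_mul_hausdorffMeasure_le_sum (hTS hx) hc hc').filter_mono
      (monotone_smallSets (nhdsWithin_mono x hTS))
  calc μH[(m : ℝ)] S = μH[(m : ℝ)] T := (measure_congr hTae).symm
    _ ≤ ∑ j, μH[(m : ℝ)] (coordProj j '' T) :=
      ENNReal.le_of_forall_lt_one_mul_le fun c' hc' =>
        ENNReal.le_of_forall_lt_one_mul_le fun c hc => hmul c hc c' hc'
    _ ≤ ∑ j, μH[(m : ℝ)] (coordProj j '' S) :=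
      Finset.sum_le_sum fun j _ => measure_mono (image_mono hTS)

end SmoothHypersurfaces

theorem theorem1p6_general {m : ℕ} {S : Set (EuclideanSpace ℝ (Fin (m + 1)))}
    (hcube : ∀ x ∈ S, ∀ i, x i ∈ Icc (0 : ℝ) 1) (hinj : ∀ j, InjOn (coordProj j) S)
    (hS : IsSmoothHypersurface S) :
    μH[(m : ℝ)] S ≤ ∑ j, μH[(m : ℝ)] (coordProj j '' S) ∧
      μH[(m : ℝ)] S ≤ ((m + 1 : ℕ) : ℝ≥0∞) * ENNReal.ofReal (sigmaConst m) := by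
  have hsum := hS.hausdorffMeasure_le_sum_coordProj hinj
  refine ⟨hsum, hsum.trans ?_⟩
  simpa using Finset.sum_le_sum fun j (_ : j ∈ Finset.univ) =>
    hausdorffMeasure_coordProj_image_le_sigmaConst hcube j

theorem theorem1p6 (n : ℕ) (hn : 1 ≤ n) (S : Set (EuclideanSpace ℝ (Fin n)))
    (hS : IsCubeAntichain S) (hsmooth : IsSmoothHypersurface S) :
    μH[((n - 1 : ℕ) : ℝ)] S ≤ ∑ j : Fin n, μH[((n - 1 : ℕ) : ℝ)] (coordProj j '' S) ∧
      μH[((n - 1 : ℕ) : ℝ)] S ≤ (n : ENNReal) * ENNReal.ofReal (sigmaConst (n - 1)) := by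
  obtain ⟨m, rfl⟩ := Nat.exists_eq_add_of_le' hn
  exact theorem1p6_general hS.1 (injOn_coordProj_of_isAntichain hS.2) hsmooth
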